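/- For a permutation $\pi=\pi(1)\cdots\pi(n)$ in the symmetric group $\mathfrak S_n$, let ${\rm run}(\pi)$ be the number of alternating runs of $\pi$, i.e. of maximal segments of at least two consecutive entries that are increasing or decreasing, and let ${\rm as}(\pi)$ be the length of a longest alternating subsequence of $\pi$, i.e. of a subsequence $\pi(i_1)>\pi(i_2)<\pi(i_3)>\cdots\pi(i_k)$ with $i_1<i_2<\cdots<i_k$. Let $$R_n(x)=\sum_{\pi\in\mathfrak S_n}x^{{\rm run}(\pi)},\qquad S_n(x)=\sum_{\pi\in\mathfrak S_n}x^{{\rm as}(\pi)}$$ be the type $A$ alternating run polynomials and the up-down run polynomials. For $n\ge 1$ set $$s_n(x)=(-1)^{n+1}(1+x)(1-x^2)^{\lfloor (n-1)/2\rfloor},\qquad r_n(x)=(-1)^{n-1}(x-1)(1-x^2)^{\lfloor (n-1)/2\rfloor}.$$ In particular, $s_1(x)=1+x$ and $r_1(x)=x-1$. Call a square matrix $(h_{ij})$ lower Hessenberg if $h_{ij}=0$ whenever $j>i+1$. Theorem. Let $n\ge 1$. (1) $S_{n+1}(x)=\det\,(a_{ij})_{1\le i,j\le n}$, where $(a_{ij})$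 is the lower Hessenberg matrix of order $n$ with $a_{i1}=x\,s_i(x)$ for $1\le i\le n$, $a_{ij}=\binom{i}{j-1}s_{i-j+1}(x)$ for $2\le j\le i\le n$, $a_{i,i+1}=-1$ for $1\le i\le n-1$, and $a_{ij}=0$ for $j>i+1$: $$S_{n+1}(x)=\begin{vmatrix} xs_1(x)&-1&0&\cdots&0\\ xs_2(x)&\binom{2}{1}s_1(x)&-1&\cdots&0\\ \vdots&\vdots&\vdots&\ddots&\vdots\\ xs_{n-1}(x)&\binom{n-1}{1}s_{n-2}(x)&\binom{n-1}{2}s_{n-3}(x)&\cdots&-1\\ xs_n(x)&\binom{n}{1}s_{n-1}(x)&\binom{n}{2}s_{n-2}(x)&\cdots&\binom{n}{n-1}s_1(x) \end{vmatrix}.$$ (2) $R_{n+1}(x)=\det\,(b_{ij})_{0\le i,j\le n}$, where $(b_{ij})$ is the lower Hessenberg matrix of order $n+1$ with $b_{00}=1$, $b_{i0}=r_i(x)$ for $1\le i\le n$, $b_{ij}=\binom{i}{j-1}s_{i-j+1}(x)$ for $1\le j\le i\le n$, $b_{i,i+1}=-1$ for $0\le i\le n-1$, and $b_{ij}=0$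 for $j>i+1$: $$R_{n+1}(x)=\begin{vmatrix} 1&-1&0&0&\cdots&0\\ r_1(x)&s_1(x)&-1&0&\cdots&0\\ r_2(x)&s_2(x)&\binom{2}{1}s_1(x)&-1&\cdots&0\\ \vdots&\vdots&\vdots&\vdots&\ddots&\vdots\\ r_{n-1}(x)&s_{n-1}(x)&\binom{n-1}{1}s_{n-2}(x)&\binom{n-1}{2}s_{n-3}(x)&\cdots&-1\\ r_n(x)&s_n(x)&\binom{n}{1}s_{n-1}(x)&\binom{n}{2}s_{n-2}(x)&\cdots&\binom{n}{n-1}s_1(x) \end{vmatrix}.$$ -/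

import Mathlib

open Polynomial

namespace AltRun

section Words

variable {α : Type*} [LinearOrder α] {n : ℕ}

/-- The segment `w i, w (i+1), ..., w j` of the word `w` has at least two entries and is either
increasing or decreasing. -/
def IsMonotoneSegment (w : Fin n → α) (i j : Fin n) : Prop :=
  i < j ∧ (StrictMonoOn w (Set.Icc i j) ∨ StrictAntiOn w (Set.Icc i j))

/-- A run of the word `w`: a monotone segment that is not contained in a longer one. -/
def IsRun (w : Fin n → α) (i j : Fin n) : Prop :=
  IsMonotoneSegment w i j ∧
    ∀ i' j' : Fin n, IsMonotoneSegment w i' j' → i' ≤ i → j ≤ j' → i' = i ∧ j' = j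

/-- The number of (alternating) runs of the word `w`. -/
noncomputable def runCount (w : Fin n → α) : ℕ :=
  {p : Fin n × Fin n | IsRun w p.1 p.2}.ncard

/-- The word `u 0, u 1, ..., u (k-1)` satisfies `u 0 > u 1 < u 2 > u 3 < ...`. -/
def IsAlternating {k : ℕ} (u : Fin k → α) : Prop :=
  ∀ (i : ℕ) (h : i + 1 < k),
    (Even i → u ⟨i + 1, h⟩ < u ⟨i, Nat.lt_of_succ_lt h⟩) ∧
      (Odd i → u ⟨i, Nat.lt_of_succ_lt h⟩ < u ⟨i + 1, h⟩)

/-- The length of the longest alternating subsequence of the word `w`. The set below contains `0`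
and is bounded above by `n`, so the supremum is a maximum. -/
noncomputable def longestAlternating (w : Fin n → α) : ℕ :=
  sSup {k : ℕ | ∃ f : Fin k → Fin n, StrictMono f ∧ IsAlternating (w ∘ f)}

end Words

/-- The type A alternating run polynomial: the sum of `x ^ run π` over the permutations `π`. -/
noncomputable def R (n : ℕ) : ℤ[X] :=
  ∑ π : Equiv.Perm (Fin n), X ^ runCount (π : Fin n → Fin n)

/-- The up-down run polynomial: the sum of `x ^ as π` over the permutations `π`, where `as π` is
the length of the longest alternating subsequence of `π`. -/
noncomputable def S (n : ℕ) : ℤ[X] :=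
  ∑ π : Equiv.Perm (Fin n), X ^ longestAlternating (π : Fin n → Fin n)

/-- The polynomials `s n`, used for `n ≥ 1` only. -/
noncomputable def s (n : ℕ) : ℤ[X] :=
  (-1) ^ (n + 1) * (1 + X) * (1 - X ^ 2) ^ ((n - 1) / 2)

/-- The polynomials `r n`, used for `n ≥ 1` only. -/
noncomputable def r (n : ℕ) : ℤ[X] :=
  (-1) ^ (n - 1) * (X - 1) * (1 - X ^ 2) ^ ((n - 1) / 2)

/-- A square matrix is lower Hessenberg if it vanishes above the first superdiagonal. -/
def IsLowerHessenberg {A : Type*} [Zero A] {m : ℕ} (M : Matrix (Fin m) (Fin m) A) : Prop :=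
  ∀ i j : Fin m, (i : ℕ) + 1 < j → M i j = 0

/-- The matrix of order `n` for `S (n + 1)`. Rows and columns are numbered from `0`: row `i` is
`x s_{i+1}, binom(i+1,1) s_i, binom(i+1,2) s_{i-1}, ..., binom(i+1,i) s_1, -1, 0, ..., 0`. -/
noncomputable def matS (n : ℕ) : Matrix (Fin n) (Fin n) ℤ[X] :=
  Matrix.of fun i j =>
    if (j : ℕ) = 0 then X * s ((i : ℕ) + 1)
    else if (j : ℕ) ≤ i then (((i : ℕ) + 1).choose j : ℤ[X]) * s ((i : ℕ) + 1 - j)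
    else if (j : ℕ) = i + 1 then -1
    else 0

/-- The matrix of order `n + 1` for `R (n + 1)`. Rows and columns are numbered from `0`: row `0` is
`1, -1, 0, ..., 0`, and row `i ≥ 1` is
`r_i, s_i, binom(i,1) s_{i-1}, binom(i,2) s_{i-2}, ..., binom(i,i-1) s_1, -1, 0, ..., 0`. -/
noncomputable def matR (n : ℕ) : Matrix (Fin (n + 1)) (Fin (n + 1)) ℤ[X] :=
  Matrix.of fun i j =>
    if (j : ℕ) = 0 then (if (i : ℕ) = 0 then 1 else r (i : ℕ))
    else if (j : ℕ) ≤ i then ((i : ℕ).choose (j - 1) : ℤ[X]) * s ((i : ℕ) + 1 - j)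
    else if (j : ℕ) = i + 1 then -1
    else 0

end AltRun

open Polynomial

namespace AltRun

/-! ### Counting turns, and the effect of inserting a new maximum -/

section Turns

variable {α : Type*} [LinearOrder α]

/-! For distinct letters, the longest alternating subsequence has length one plus the number of
turns, with an imaginary ascent before the first letter. Inserting a new maximum into `n` letters
with statistic `k` gives `k` words with statistic `k`, one with `k+1` and `n-k` with `k+2`. Hence
`S_{n+1} = x(nx+1) S_n + x(1-x^2) S_n'`.

The coefficients of `A = 1 - ∑ s_n z^n/n!` obey a recurrence with the same derivative term, so the
coefficients of `A · ∑ S_{n+1} z^n/n!` do too. This product starts with `x`, and the recurrence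
sends `x` to `0`, so the product is the constant `x`. This is the binomial recurrence for `S`.
Complementing permutations gives `2 S_n = (1+x) R_n` for `n ≥ 2`, which transfers the recurrence to
`R`, with `r_n` correcting the initial term.

Each recurrence says that the Hessenberg matrix sends the vector of earlier polynomials to a
multiple of the last basis vector; Cramer's rule then gives the determinant. -/

/-- The number of changes of direction along the word `a :: l`, when the step leading to `a` is
an ascent (`d = true`) or a descent (`d = false`). -/
def turns : Bool → α → List α → ℕ
  | _, _, [] => 0
  | d, a, b :: l => (if decide (a < b) = d then 0 else 1) + turns (decide (a < b)) b l

/-- The length of the longest alternating subsequence of a list, computed from its turns. -/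
def upDownRuns : List α → ℕ
  | [] => 0
  | a :: l => 1 + turns true a l

/-- The two incoming directions feed each other in the induction, so they are proved together. The
extra term in the second identity is the weight of placing `M` just before `a`. -/
theorem insertion_sum_turns (M : α) (l : List α) (hl : ∀ b ∈ l, b < M) (a : α) (ha : a < M) :
    (((l.permutations'Aux M).map fun m => (X : ℤ[X]) ^ turns false a m).sum =
      (turns false a l : ℤ[X]) * X ^ turns false a l + X ^ (turns false a l + 1) +
        ((l.length : ℤ[X]) - (turns false a l : ℤ[X])) * X ^ (turns false a l + 2)) ∧
    ((X : ℤ[X]) ^ (1 + turns false a l) +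
        ((l.permutations'Aux M).map fun m => (X : ℤ[X]) ^ turns true a m).sum =
      ((turns true a l : ℤ[X]) + 1) * X ^ turns true a l + X ^ (turns true a l + 1) +
        ((l.length : ℤ[X]) - (turns true a l : ℤ[X])) * X ^ (turns true a l + 2)) := by
  induction l generalizing a with
  | nil => simp [turns, ha, add_comm]
  | cons b l ih =>
    have hb : b < M := hl b (by simp)
    obtain ⟨ihf, iht⟩ := ih (fun c hc => hl c (by simp [hc])) b hb
    have hMb : decide (M < b) = false := by simp [hb.le]
    have haM : decide (a < M) = true := by simp [ha]
    by_cases hab : a < b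
    · have hd : decide (a < b) = true := by simp [hab]
      simp only [List.permutations'Aux, List.map_cons, List.map_map, List.sum_cons,
        Function.comp_def, turns, hd, haM, hMb, pow_add, List.sum_map_mul_left, List.length_cons]
      simp only [if_true, Bool.true_eq_false, Bool.false_eq_true, if_false, pow_zero, one_mul,
        zero_add, pow_one, pow_add] at *
      push_cast
      constructor
      · linear_combination X * iht
      · linear_combination iht
    · have hd : decide (a < b) = false := by simp [hab]
      simp only [List.permutations'Aux, List.map_cons, List.map_map, List.sum_cons,
        Function.comp_def, turns, hd, haM, hMb, pow_add, List.sum_map_mul_left, List.length_cons]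
      simp only [if_true, Bool.true_eq_false, Bool.false_eq_true, if_false, pow_zero, one_mul,
        zero_add, pow_one, pow_add] at *
      push_cast
      constructor
      · linear_combination ihf
      · linear_combination X * ihf

/-- The counts `k`, `1`, `n - k` become a differential operator because `k X^k = X (X^k)'`. -/
theorem insertion_sum_upDownRuns (M : α) (l : List α) (hl : ∀ b ∈ l, b < M) (h : l ≠ []) :
    ((l.permutations'Aux M).map fun m => (X : ℤ[X]) ^ upDownRuns m).sum =
      X * ((l.length : ℤ[X]) * X + 1) * X ^ upDownRuns l +
        X * (1 - X ^ 2) * derivative (X ^ upDownRuns l) := by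
  cases l with
  | nil => exact absurd rfl h
  | cons a l =>
    have ha : a < M := hl a (by simp)
    have key := (insertion_sum_turns M l (fun c hc => hl c (by simp [hc])) a ha).2
    have hMa : decide (M < a) = false := by simp [ha.le]
    simp only [List.permutations'Aux, List.map_cons, List.map_map, List.sum_cons,
      Function.comp_def, upDownRuns, turns, hMa, pow_add, List.sum_map_mul_left, List.length_cons,
      pow_one, Bool.false_eq_true, if_false, derivative_mul, derivative_X,
      derivative_X_pow, one_mul] at key ⊢
    have hX : (X : ℤ[X]) * (C ((turns true a l : ℕ) : ℤ) * X ^ (turns true a l - 1)) =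
        (turns true a l : ℤ[X]) * X ^ turns true a l := by
      rcases Nat.eq_zero_or_pos (turns true a l) with h0 | h0
      · simp [h0]
      · obtain ⟨k, hk⟩ := Nat.exists_eq_succ_of_ne_zero h0.ne'
        rw [hk]
        simp [pow_succ]
        ring
    push_cast at *
    linear_combination X * key - X * (1 - X ^ 2) * hX

/-- The generating polynomial of `upDownRuns` over the arrangements of `0, ..., n - 1`. -/
noncomputable def upDownSum (n : ℕ) : ℤ[X] :=
  (((List.range n).reverse.permutations').map fun l => (X : ℤ[X]) ^ upDownRuns l).sum

theorem upDownSum_one : upDownSum 1 = X := by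
  simp [upDownSum, List.permutations', upDownRuns, turns, List.range_succ, List.permutations'Aux]

theorem upDownSum_succ (n : ℕ) (hn : 1 ≤ n) :
    upDownSum (n + 1) = X * ((n : ℤ[X]) * X + 1) * upDownSum n +
      X * (1 - X ^ 2) * derivative (upDownSum n) := by
  have hder : derivative (upDownSum n) = (((List.range n).reverse.permutations').map
      fun l => derivative ((X : ℤ[X]) ^ upDownRuns l)).sum := by
    rw [upDownSum, map_list_sum, List.map_map]
    rfl
  rw [hder]
  unfold upDownSum
  -- The range is reversed so that its head is the largest letter `n`, which `permutations'` inserts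
  -- last.
  rw [← List.sum_map_mul_left, ← List.sum_map_mul_left, ← List.sum_map_add, List.range_succ,
    List.reverse_append, List.reverse_singleton, List.singleton_append, List.permutations',
    List.map_flatMap, List.flatMap_def, List.sum_flatten, List.map_map]
  congr 1
  refine List.map_congr_left fun l hl => ?_
  rw [List.mem_permutations'] at hl
  have hlen : l.length = n := by simpa using hl.length_eq
  have := insertion_sum_upDownRuns n l (fun b hb => by simpa using hl.mem_iff.1 hb)
    (by rintro rfl; simp at hlen; omega)
  rw [Function.comp_apply, this, hlen]

end Turns

/-! ### The binomial recurrence from the differential one -/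

section Recurrence

/-- The coefficients of `1 - ∑ s n z ^ n / n !`. -/
noncomputable def oneSubS (n : ℕ) : ℤ[X] := if n = 0 then 1 else -s n

theorem s_two_mul_add_one (m : ℕ) : s (2 * m + 1) = (1 + X) * (1 - X ^ 2) ^ m := by
  have h : (2 * m + 1 - 1) / 2 = m := by omega
  rw [s, h, pow_succ, pow_succ, pow_mul]
  simp

theorem s_two_mul_add_two (m : ℕ) : s (2 * m + 2) = -((1 + X) * (1 - X ^ 2) ^ m) := by
  have h : (2 * m + 2 - 1) / 2 = m := by omega
  rw [s, h, show 2 * m + 2 + 1 = 2 * (m + 1) + 1 by ring, pow_succ, pow_mul]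
  simp
  ring

/-- The derivative term matches that of `upDownSum_succ`, so the product rule will apply to the
convolution. -/
theorem oneSubS_succ (n : ℕ) :
    oneSubS (n + 1) = ((n : ℤ[X]) * X ^ 2 - (1 + X)) * oneSubS n +
      X * (1 - X ^ 2) * derivative (oneSubS n) := by
  rcases Nat.eq_zero_or_pos n with rfl | hn
  · simp [oneSubS, s]
  have hder : ∀ m : ℕ, X * (1 - X ^ 2) * derivative (((1 : ℤ[X]) - X ^ 2) ^ m) =
      -(2 * (m : ℤ[X])) * X ^ 2 * (1 - X ^ 2) ^ m := by
    intro m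
    cases m with
    | zero => simp
    | succ m =>
      rw [derivative_pow_succ]
      simp
      ring
  have hpos : ∀ m : ℕ, 0 < m → oneSubS m = -s m := fun m hm => if_neg hm.ne'
  rw [hpos _ hn, hpos _ n.succ_pos]
  rcases Nat.even_or_odd' n with ⟨m, rfl | rfl⟩
  · obtain ⟨k, rfl⟩ : ∃ k, m = k + 1 := ⟨m - 1, by omega⟩
    rw [s_two_mul_add_one, show 2 * (k + 1) = 2 * k + 2 by ring, s_two_mul_add_two]
    simp only [derivative_neg, derivative_mul, derivative_add, derivative_one, derivative_X]
    push_cast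
    linear_combination (-(1 + X)) * hder k
  · rw [s_two_mul_add_one, show (2 * m + 1).succ = 2 * m + 2 by rfl, s_two_mul_add_two]
    simp only [derivative_neg, derivative_mul, derivative_add, derivative_one, derivative_X]
    push_cast
    linear_combination (1 + X) * hder m

open Finset in
-- By Pascal and the product rule, the multipliers `(i+1)X^2 + X` and `jX^2 - 1 - X` add up to
-- `(n+1)X^2 - 1`, which depends only on `n = i + j`. So the convolution obeys its own recurrence,
-- and its zeroth value `X` is sent to `0`.
theorem convolution_eq_zero (n : ℕ) :
    ∑ p ∈ antidiagonal (n + 1), ((n + 1).choose p.1 : ℤ[X]) *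
      (upDownSum (p.1 + 1) * oneSubS p.2) = 0 := by
  have hstep : ∀ n : ℕ, ∑ p ∈ antidiagonal (n + 1), ((n + 1).choose p.1 : ℤ[X]) *
      (upDownSum (p.1 + 1) * oneSubS p.2) =
      ((n : ℤ[X]) * X ^ 2 + X ^ 2 - 1) * (∑ p ∈ antidiagonal n, (n.choose p.1 : ℤ[X]) *
        (upDownSum (p.1 + 1) * oneSubS p.2)) +
      X * (1 - X ^ 2) * derivative (∑ p ∈ antidiagonal n, (n.choose p.1 : ℤ[X]) *
        (upDownSum (p.1 + 1) * oneSubS p.2)) := by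
    intro n
    rw [sum_antidiagonal_choose_succ_mul (fun i j => upDownSum (i + 1) * oneSubS j),
      derivative_sum, mul_sum, mul_sum, ← sum_add_distrib, ← sum_add_distrib]
    refine sum_congr rfl fun p hp => ?_
    have hpn : p.1 + p.2 = n := mem_antidiagonal.1 hp
    rw [← Nat.choose_symm_of_eq_add hpn.symm, oneSubS_succ, upDownSum_succ (p.1 + 1) (by omega)]
    have hn : (n : ℤ[X]) = p.1 + p.2 := by rw [← hpn]; push_cast; ring
    rw [hn]
    simp only [derivative_mul, derivative_natCast]
    push_cast
    ring
  induction n with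
  | zero =>
    rw [hstep 0]
    simp [upDownSum_one, oneSubS]
    ring
  | succ n ih => rw [hstep (n + 1), ih]; simp

theorem upDownSum_recurrence (n : ℕ) (hn : 1 ≤ n) :
    upDownSum (n + 1) =
      ∑ k ∈ Finset.range n, (n.choose k : ℤ[X]) * (s (n - k) * upDownSum (k + 1)) := by
  obtain ⟨m, rfl⟩ : ∃ m, n = m + 1 := ⟨n - 1, by omega⟩
  have h := convolution_eq_zero m
  rw [Finset.Nat.sum_antidiagonal_eq_sum_range_succ_mk, Finset.sum_range_succ] at h
  have h2 : ∑ k ∈ Finset.range (m + 1), ((m + 1).choose k : ℤ[X]) *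
      (upDownSum (k + 1) * oneSubS (m + 1 - k)) =
      -∑ k ∈ Finset.range (m + 1), ((m + 1).choose k : ℤ[X]) *
        (s (m + 1 - k) * upDownSum (k + 1)) := by
    rw [← Finset.sum_neg_distrib]
    refine Finset.sum_congr rfl fun k hk => ?_
    have : m + 1 - k ≠ 0 := by have := Finset.mem_range.1 hk; omega
    rw [oneSubS, if_neg this]
    ring
  simp only [h2] at h
  simp [oneSubS] at h
  linear_combination h

end Recurrence

/-! ### Cramer's rule for Hessenberg matrices -/

section Hessenberg

/-- A Hessenberg matrix `M` with superdiagonal `-1` which maps `u` to `t` times the last basis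
vector satisfies `det M * u 0 = t`. -/
theorem det_mul_eq_of_hessenberg {A : Type*} [CommRing A] {m : ℕ}
    (M : Matrix (Fin (m + 1)) (Fin (m + 1)) A) (hM : IsLowerHessenberg M)
    (hsup : ∀ i j : Fin (m + 1), (j : ℕ) = i + 1 → M i j = -1)
    (u : Fin (m + 1) → A) (t : A) (hu : M.mulVec u = Pi.single (Fin.last m) t) :
    M.det * u 0 = t := by
  have h1 : M.adjugate.mulVec (M.mulVec u) 0 = M.det * u 0 := by
    rw [Matrix.mulVec_mulVec, Matrix.adjugate_mul, Matrix.smul_mulVec, Matrix.one_mulVec]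
    rfl
  rw [← h1, hu, Matrix.mulVec_single, Pi.smul_apply, Matrix.col_apply,
    Matrix.adjugate_fin_succ_eq_det_submatrix]
  -- Only one cofactor survives. Deleting the last row and first column moves the superdiagonal onto
  -- the diagonal, and the resulting `(-1)^m` cancels the cofactor sign.
  have hdet : (M.submatrix (Fin.last m).succAbove (0 : Fin (m + 1)).succAbove).det =
      (-1) ^ m := by
    rw [Matrix.det_of_isLowerTriangular]
    · rw [Finset.prod_congr rfl fun i _ => ?_, Finset.prod_const, Finset.card_univ,
        Fintype.card_fin]
      simp only [Matrix.submatrix_apply, Fin.succAbove_last, Fin.succAbove_zero]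
      exact hsup _ _ (by simp)
    · intro i j hij
      simp only [Matrix.submatrix_apply, Fin.succAbove_last, Fin.succAbove_zero]
      apply hM
      have : (i : ℕ) < j := hij
      simp
      omega
  rw [hdet, Fin.val_last, Fin.val_zero, add_zero, ← mul_pow]
  simp

end Hessenberg

/-! ### Longest alternating subsequences and turns -/

section Alternating

variable {α : Type*} [LinearOrder α]

/-- The list descends and ascends alternately, starting with a descent if `d = true` and with an
ascent if `d = false`. -/
def AlternatesFrom : Bool → List α → Prop
  | _, [] => True
  | _, [_] => True
  | d, a :: b :: l => (if d then b < a else a < b) ∧ AlternatesFrom (!d) (b :: l)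

theorem AlternatesFrom.tail {d : Bool} {l : List α} (h : AlternatesFrom d l) :
    AlternatesFrom (!d) l.tail := by
  rcases l with _ | ⟨a, _ | ⟨b, l⟩⟩
  · trivial
  · trivial
  · exact h.2

/-- If the step from `a` to `b` makes no turn, `b` is a better start than `a` and can replace it; if
it makes one, dropping the first letter of `v` costs exactly that turn. -/
theorem AlternatesFrom.length_le {d : Bool} {a : α} {l v : List α} (hl : (a :: l).Nodup)
    (hv : AlternatesFrom d v) (hs : v.Sublist (a :: l)) : v.length ≤ 1 + turns d a l := by
  induction l generalizing d a v with
  | nil => simpa [turns] using hs.length_le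
  | cons b l ih =>
    have hbl : (b :: l).Nodup := hl.of_cons
    have hne : a ≠ b := by rintro rfl; simp at hl
    by_cases hd : decide (a < b) = d
    · have : turns d a (b :: l) = turns d b l := by simp [turns, hd]
      rw [this]
      cases hs with
      | cons _ h => exact ih hbl hv h
      | cons_cons _ h =>
        rename_i u
        rcases u with _ | ⟨c, u⟩
        · simp
        · have hcb : c ≠ b := by
            rintro rfl
            have := hv.1
            cases d
            · simp at this hd
              exact absurd this hd.not_gt
            · simp at this hd
              exact absurd this hd.not_gt
          have hsub : (c :: u).Sublist l := by
            cases h with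
            | cons _ h => exact h
            | cons_cons _ h => exact absurd rfl hcb
          have halt : AlternatesFrom d (b :: c :: u) := by
            refine ⟨?_, hv.2⟩
            have h1 := hv.1
            cases d
            · simp at h1 hd ⊢
              exact hd.trans_lt h1
            · simp at h1 hd ⊢
              exact h1.trans hd
          simpa using ih hbl halt (hsub.cons_cons b)
    · have hdn : decide (a < b) = !d := by cases d <;> simpa using hd
      have : turns d a (b :: l) = 1 + turns (!d) b l := by simp [turns, hdn]
      rw [this]
      have htail : v.tail.Sublist (b :: l) := by simpa using hs.tail
      have := ih hbl hv.tail htail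
      rw [List.length_tail] at this
      omega

/-- Greedy choice of extrema. The final clause, that `c` is at least as extreme as `a`, is what
allows a letter to be prepended at a turn. -/
theorem exists_alternatesFrom (d : Bool) (a : α) (l : List α) (hl : (a :: l).Nodup) :
    ∃ c v, AlternatesFrom d (c :: v) ∧ (c :: v).Sublist (a :: l) ∧
      (c :: v).length = 1 + turns d a l ∧ if d then a ≤ c else c ≤ a := by
  induction l generalizing d a with
  | nil => exact ⟨a, [], trivial, List.Sublist.refl _, rfl, by simp⟩
  | cons b l ih =>
    have hbl : (b :: l).Nodup := hl.of_cons
    have hne : a ≠ b := by rintro rfl; simp at hl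
    by_cases hd : decide (a < b) = d
    · obtain ⟨c, v, h1, h2, h3, h4⟩ := ih d b hbl
      refine ⟨c, v, h1, h2.cons a, by simp [turns, hd, h3], ?_⟩
      cases d
      · simp at hd h4 ⊢
        exact h4.trans hd
      · simp at hd h4 ⊢
        exact hd.le.trans h4
    · have hdn : decide (a < b) = !d := by cases d <;> simpa using hd
      obtain ⟨c, v, h1, h2, h3, h4⟩ := ih (!d) b hbl
      refine ⟨a, c :: v, ⟨?_, h1⟩, h2.cons_cons a, ?_, by simp⟩
      · cases d
        · simp at hdn h4 ⊢
          exact hdn.trans_le h4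
        · simp at hdn h4 ⊢
          exact h4.trans_lt (lt_of_le_of_ne hdn hne.symm)
      · rw [List.length_cons, h3]
        simp [turns, hdn]
        omega

theorem alternatesFrom_iff_getElem (d : Bool) (v : List α) :
    AlternatesFrom d v ↔ ∀ (i : ℕ) (h : i + 1 < v.length),
      if (Even i ↔ d = true) then v[i + 1] < v[i] else v[i] < v[i + 1] := by
  induction v generalizing d with
  | nil => simp [AlternatesFrom]
  | cons a v ih =>
    rcases v with _ | ⟨b, v⟩
    · simp [AlternatesFrom]
    · rw [AlternatesFrom, ih]
      constructor
      · rintro ⟨h0, h⟩ i hi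
        rcases i with _ | i
        · simpa using h0
        · have := h i (by simpa using hi)
          cases d <;> simpa [Nat.even_add_one, ← Nat.not_even_iff_odd] using this
      · intro h
        refine ⟨by simpa using h 0 (by simp), fun i hi => ?_⟩
        have := h (i + 1) (by simpa using hi)
        cases d <;> simpa [Nat.even_add_one, ← Nat.not_even_iff_odd] using this

theorem isAlternating_iff {k : ℕ} (u : Fin k → α) :
    IsAlternating u ↔ AlternatesFrom true (List.ofFn u) := by
  rw [alternatesFrom_iff_getElem]
  simp only [List.length_ofFn, List.getElem_ofFn, iff_true, IsAlternating]
  refine forall₂_congr fun i h => ?_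
  by_cases hi : Even i
  · have : ¬ Odd i := by simpa using hi
    simp [hi, this]
  · have : Odd i := by simpa using hi
    simp [hi, this]

theorem longestAlternating_eq_upDownRuns {n : ℕ} (w : Fin n → α) (hw : Function.Injective w) :
    longestAlternating w = upDownRuns (List.ofFn w) := by
  have hset : {k : ℕ | ∃ f : Fin k → Fin n, StrictMono f ∧ IsAlternating (w ∘ f)} =
      {k : ℕ | ∃ v : List α, v.Sublist (List.ofFn w) ∧ AlternatesFrom true v ∧ v.length = k} := by
    ext k
    constructor
    · rintro ⟨f, hf, ha⟩
      refine ⟨List.ofFn (w ∘ f), ?_, (isAlternating_iff _).1 ha, by simp⟩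
      rw [List.sublist_iff_exists_fin_orderEmbedding_get_eq]
      refine ⟨OrderEmbedding.ofStrictMono (fun i => Fin.cast (by simp) (f (Fin.cast (by simp) i)))
        fun i j hij => hf hij, fun i => ?_⟩
      rw [List.get_ofFn, List.get_ofFn]
      rfl
    · rintro ⟨v, hv, ha, rfl⟩
      obtain ⟨f, hf⟩ := List.sublist_iff_exists_fin_orderEmbedding_get_eq.1 hv
      refine ⟨fun i => Fin.cast (by simp) (f i), fun i j hij => f.strictMono hij, ?_⟩
      rw [isAlternating_iff]
      convert ha
      refine List.ext_get (by simp) fun i h1 h2 => ?_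
      have := hf ⟨i, h2⟩
      rw [this, List.get_ofFn, List.get_ofFn]
      rfl
  have hnodup : (List.ofFn w).Nodup := List.nodup_ofFn.2 hw
  rw [longestAlternating, hset]
  apply IsGreatest.csSup_eq
  cases h : List.ofFn w with
  | nil =>
    refine ⟨⟨[], by simp, trivial, rfl⟩, ?_⟩
    rintro k ⟨v, hv, -, rfl⟩
    simp_all [upDownRuns]
  | cons a l =>
    rw [h] at hnodup
    constructor
    · obtain ⟨c, v, h1, h2, h3, -⟩ := exists_alternatesFrom true a l hnodup
      exact ⟨c :: v, h2, h1, h3⟩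
    · rintro k ⟨v, hv, ha, rfl⟩
      exact ha.length_le hnodup hv

theorem S_eq_upDownSum (n : ℕ) : S n = upDownSum n := by
  have hp := List.permutations_perm_permutations' (List.range n).reverse
  have hnodup : ((List.range n).reverse.permutations').Nodup :=
    hp.nodup_iff.1 (List.nodup_permutations _ (List.nodup_reverse.2 List.nodup_range))
  rw [upDownSum, ← List.sum_toFinset _ hnodup]
  let φ : Equiv.Perm (Fin n) → List ℕ := fun π => List.ofFn fun i => (π i : ℕ)
  have hφ : Function.Injective φ := fun π σ h => by
    ext i
    exact congrFun (List.ofFn_injective h) i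
  have himage : Finset.univ.image φ = (List.range n).reverse.permutations'.toFinset := by
    apply Finset.eq_of_subset_of_card_le
    · intro l hl
      obtain ⟨π, -, rfl⟩ := Finset.mem_image.1 hl
      rw [List.mem_toFinset, List.mem_permutations']
      refine List.Perm.trans ?_ (List.reverse_perm _).symm
      refine (List.perm_ext_iff_of_nodup (List.nodup_ofFn.2 fun i j h => ?_)
        List.nodup_range).2 fun a => ?_
      · exact π.injective (Fin.ext h)
      · rw [List.mem_ofFn, List.mem_range]
        constructor
        · rintro ⟨i, rfl⟩
          exact (π i).2
        · intro ha
          exact ⟨π.symm ⟨a, ha⟩, by simp⟩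
    · rw [List.toFinset_card_of_nodup hnodup, ← hp.length_eq, List.length_permutations,
        Finset.card_image_of_injective _ hφ, Finset.card_univ, Fintype.card_perm]
      simp
  rw [← himage, Finset.sum_image hφ.injOn, S]
  refine Finset.sum_congr rfl fun π _ => ?_
  rw [← longestAlternating_eq_upDownRuns _ fun i j h => π.injective (Fin.ext h)]
  rfl

end Alternating

/-! ### Runs, turns and the relation between `S` and `R` -/

section Runs

variable {α : Type*} [LinearOrder α]

/-- The word `w` changes direction at the inner position `i + 1`. -/
def IsTurn {n : ℕ} (w : Fin (n + 2) → α) (i : Fin n) : Prop :=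
  ¬ (w i.castSucc.castSucc < w i.succ.castSucc ↔ w i.succ.castSucc < w i.succ.succ)

instance {n : ℕ} (w : Fin (n + 2) → α) : DecidablePred (IsTurn w) :=
  fun _ => inferInstanceAs (Decidable (¬ _))

theorem card_isTurn {n : ℕ} (w : Fin (n + 2) → α) :
    (Finset.univ.filter (IsTurn w)).card =
      turns (decide (w 0 < w 1)) (w 1) (List.ofFn fun i : Fin n => w i.succ.succ) := by
  induction n with
  | zero => simp [turns]
  | succ n ih =>
    have := ih (Fin.tail w)
    rw [Fin.card_filter_univ_succ', List.ofFn_succ, turns]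
    simp only [Fin.tail] at this
    have h2 : decide (w 1 < w 2) = decide (w 0 < w 1) ↔ (w 0 < w 1 ↔ w 1 < w 2) := by
      rw [decide_eq_decide]
      exact iff_comm
    congr 1
    change (if ¬ (w 0 < w 1 ↔ w 1 < w 2) then 1 else 0) =
      if decide (w 1 < w 2) = decide (w 0 < w 1) then 0 else 1
    simp only [h2, ite_not]

theorem strictMonoOn_Icc_extend {n : ℕ} {w : Fin n → α} {i₀ i j : Fin n} (hi : (i₀ : ℕ) + 1 = i)
    (h0 : w i₀ < w i) (h : StrictMonoOn w (Set.Icc i j)) (hij : i ≤ j) :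
    StrictMonoOn w (Set.Icc i₀ j) := by
  intro x hx y hy hxy
  have hiy : i ≤ y := by
    have h1 : i₀ ≤ x := hx.1
    simp only [Fin.le_def, Fin.lt_def] at *
    omega
  rcases eq_or_lt_of_le hx.1 with rfl | hlt
  · exact h0.trans_le (h.monotoneOn ⟨le_rfl, hij⟩ ⟨hiy, hy.2⟩ hiy)
  · refine h ⟨?_, hx.2⟩ ⟨hiy, hy.2⟩ hxy
    simp only [Fin.le_def, Fin.lt_def] at *
    omega

theorem IsMonotoneSegment.extend {n : ℕ} {w : Fin n → α} (hw : Function.Injective w)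
    {i₀ i i₁ j : Fin n} (h : IsMonotoneSegment w i j) (hi : (i₀ : ℕ) + 1 = i)
    (hi' : (i : ℕ) + 1 = i₁) (hd : w i₀ < w i ↔ w i < w i₁) :
    IsMonotoneSegment w i₀ j := by
  have hij := h.1
  have hii : i < i₁ := by simp only [Fin.lt_def]; omega
  have hi1 : i₁ ≤ j := by simp only [Fin.le_def, Fin.lt_def] at *; omega
  have hne : w i₀ ≠ w i := fun he => by have := congrArg Fin.val (hw he); omega
  refine ⟨by simp only [Fin.lt_def] at *; omega, ?_⟩
  rcases h.2 with hm | hm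
  · left
    have : w i < w i₁ := hm ⟨le_rfl, hij.le⟩ ⟨hii.le, hi1⟩ hii
    exact strictMonoOn_Icc_extend hi (hd.2 this) hm hij.le
  · right
    have : w i₁ < w i := hm ⟨le_rfl, hij.le⟩ ⟨hii.le, hi1⟩ hii
    have h0 : w i < w i₀ := lt_of_le_of_ne (not_lt.1 (mt hd.1 this.not_gt)) hne.symm
    -- The decreasing case is the increasing one in the dual order.
    exact fun x hx y hy hxy => strictMonoOn_Icc_extend (α := αᵒᵈ) (w := w) hi h0
      (fun x hx y hy hxy => hm hx hy hxy) hij.le hx hy hxy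

theorem IsMonotoneSegment.not_isTurn {n : ℕ} {w : Fin (n + 2) → α} {i : Fin n}
    {i' j' : Fin (n + 2)} (h : IsMonotoneSegment w i' j') (hi : i' ≤ i.castSucc.castSucc)
    (hj : i.succ.succ ≤ j') : ¬ IsTurn w i := by
  have h01 : i.castSucc.castSucc < i.succ.castSucc := by simp [Fin.lt_def]
  have h12 : i.succ.castSucc < i.succ.succ := by simp [Fin.lt_def]
  have m0 : i.castSucc.castSucc ∈ Set.Icc i' j' := ⟨hi, (h01.trans h12).le.trans hj⟩
  have m1 : i.succ.castSucc ∈ Set.Icc i' j' := ⟨hi.trans h01.le, h12.le.trans hj⟩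
  have m2 : i.succ.succ ∈ Set.Icc i' j' := ⟨hi.trans (h01.trans h12).le, hj⟩
  rcases h.2 with hm | hm
  · exact not_not.2 (iff_of_true (hm m0 m1 h01) (hm m1 m2 h12))
  · exact not_not.2 (iff_of_false (hm m0 m1 h01).not_gt (hm m1 m2 h12).not_gt)

theorem isMonotoneSegment_of_succ {n : ℕ} {w : Fin n → α} (hw : Function.Injective w)
    {i j : Fin n} (h : (i : ℕ) + 1 = j) : IsMonotoneSegment w i j := by
  have hij : i < j := by simp only [Fin.lt_def]; omega
  refine ⟨hij, ?_⟩
  have hx : ∀ x ∈ Set.Icc i j, ∀ y ∈ Set.Icc i j, x < y → x = i ∧ y = j := by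
    intro x hx y hy hxy
    simp only [Set.mem_Icc, Fin.le_def, Fin.lt_def, Fin.ext_iff] at *
    omega
  rcases lt_or_gt_of_ne (hw.ne hij.ne) with h | h
  · left
    intro x hx' y hy' hxy
    obtain ⟨rfl, rfl⟩ := hx x hx' y hy' hxy
    exact h
  · right
    intro x hx' y hy' hxy
    obtain ⟨rfl, rfl⟩ := hx x hx' y hy' hxy
    exact h

/-- A run is determined by its left end, and the left ends are position `0` and the turns: a segment
starting at any other position extends to the left, while none extends across a turn. -/
theorem runCount_eq {n : ℕ} (w : Fin (n + 2) → α) (hw : Function.Injective w) :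
    runCount w = 1 + (Finset.univ.filter (IsTurn w)).card := by
  have hinj : Set.InjOn Prod.fst {p : Fin (n + 2) × Fin (n + 2) | IsRun w p.1 p.2} := by
    rintro ⟨i, j⟩ hp ⟨i', j'⟩ hq h
    obtain rfl : i = i' := h
    rcases le_total j j' with hj | hj
    · rw [(hp.2 i j' hq.1 le_rfl hj).2]
    · rw [(hq.2 i j hp.1 le_rfl hj).2]
  have himage : Prod.fst '' {p : Fin (n + 2) × Fin (n + 2) | IsRun w p.1 p.2} =
      ↑(insert 0 ((Finset.univ.filter (IsTurn w)).image fun i => i.succ.castSucc)) := by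
    ext i
    simp only [Set.mem_image, Set.mem_ofPred_eq, Prod.exists, exists_and_right, exists_eq_right,
      Finset.coe_insert, Set.mem_insert_iff, Finset.mem_coe, Finset.mem_image, Finset.mem_filter,
      Finset.mem_univ, true_and]
    constructor
    · rintro ⟨j, hseg, hmax⟩
      by_contra! hcon
      obtain ⟨h0, hT⟩ := hcon
      have hij : (i : ℕ) < j := hseg.1
      have h0' : (i : ℕ) ≠ 0 := fun h => h0 (Fin.ext h)
      have hi := i.2
      have hj := j.2
      obtain ⟨k, hk⟩ : ∃ k : Fin n, k.succ.castSucc = i :=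
        ⟨⟨i - 1, by omega⟩, by ext; simp; omega⟩
      have hnt : ¬ IsTurn w k := fun h => hT k h hk
      subst hk
      have hext := hseg.extend hw (i₀ := k.castSucc.castSucc) (i₁ := k.succ.succ) (by simp)
        (by simp) (not_not.1 hnt)
      have := (hmax _ _ hext (by simp [Fin.le_def]) le_rfl).1
      simp [Fin.ext_iff] at this
    · intro hi
      have hlt : (i : ℕ) + 1 < n + 2 := by
        rcases hi with rfl | ⟨k, -, rfl⟩
        · simp
        · simp
      obtain ⟨j, hj, hjmax⟩ := (Set.toFinite {j | IsMonotoneSegment w i j}).exists_maximal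
        ⟨⟨i + 1, hlt⟩, isMonotoneSegment_of_succ hw rfl⟩
      refine ⟨j, hj, fun i' j' h hi' hj' => ?_⟩
      obtain rfl : i' = i := by
        by_contra hne
        have hlt' : (i' : ℕ) < i := lt_of_le_of_ne hi' fun h => hne (Fin.ext h)
        have hij : (i : ℕ) < j := hj.1
        rcases hi with rfl | ⟨k, hk, rfl⟩
        · simp at hlt'
        · refine h.not_isTurn ?_ ?_ hk
          · simp only [Fin.le_def, Fin.val_castSucc, Fin.val_succ] at *; omega
          · simp only [Fin.le_def, Fin.val_castSucc, Fin.val_succ] at *; omega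
      exact ⟨rfl, le_antisymm (hjmax h hj') hj'⟩
  rw [runCount, ← hinj.ncard_image, himage, Set.ncard_coe_finset,
    Finset.card_insert_of_notMem (by simp [Fin.ext_iff]),
    Finset.card_image_of_injective _ (fun i j h => by simpa using h), add_comm]

/-- Both sides count turns; the imaginary initial ascent adds one exactly when the word begins with
a descent. -/
theorem longestAlternating_eq_runCount_add {n : ℕ} (w : Fin (n + 2) → α)
    (hw : Function.Injective w) :
    longestAlternating w = runCount w + if w 0 < w 1 then 0 else 1 := by
  rw [longestAlternating_eq_upDownRuns w hw, runCount_eq w hw, card_isTurn, List.ofFn_succ,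
    List.ofFn_succ, upDownRuns, turns]
  by_cases h : w 0 < w 1
  · simp [h]
  · simp [h]
    ring

theorem isMonotoneSegment_rev {m n : ℕ} (w : Fin n → Fin m) (i j : Fin n) :
    IsMonotoneSegment (Fin.rev ∘ w) i j ↔ IsMonotoneSegment w i j := by
  simp only [IsMonotoneSegment, StrictMonoOn, StrictAntiOn, Function.comp_apply, Fin.rev_lt_rev]
  rw [or_comm]

theorem runCount_rev {m n : ℕ} (w : Fin n → Fin m) : runCount (Fin.rev ∘ w) = runCount w := by
  simp only [runCount, IsRun, isMonotoneSegment_rev]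

/-- A permutation and its complement have equally many runs and opposite first steps, so together
they contribute `(1 + X) X^run`. -/
theorem two_mul_S (n : ℕ) : 2 * S (n + 2) = (1 + X) * R (n + 2) := by
  have hrev : S (n + 2) = ∑ π : Equiv.Perm (Fin (n + 2)),
      (X : ℤ[X]) ^ longestAlternating (Fin.rev ∘ π) := by
    rw [S, ← Equiv.sum_comp (Equiv.mulLeft (Fin.revPerm (n := n + 2)))]
    rfl
  rw [two_mul]
  nth_rewrite 2 [hrev]
  rw [S, R, ← Finset.sum_add_distrib, Finset.mul_sum]
  refine Finset.sum_congr rfl fun π _ => ?_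
  rw [longestAlternating_eq_runCount_add _ π.injective,
    longestAlternating_eq_runCount_add _ (Fin.rev_injective.comp π.injective), runCount_rev]
  have hne : π 0 ≠ π 1 := π.injective.ne (by simp)
  rcases lt_or_gt_of_ne hne with h | h
  · simp [h, h.not_gt, pow_succ]
    ring
  · simp [h, h.not_gt, pow_succ]
    ring

theorem R_one : R 1 = 1 := by
  have : ∀ w : Fin 1 → Fin 1, runCount w = 0 := fun w => by
    rw [runCount, Set.ncard_eq_zero]
    ext p
    simp [IsRun, IsMonotoneSegment, Subsingleton.elim p.1 p.2]
  simp [R, this]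

end Runs

/-! ### Recurrences as determinants -/

section Determinants

theorem S_one : S 1 = X := by rw [S_eq_upDownSum, upDownSum_one]

theorem S_recurrence (n : ℕ) (hn : 1 ≤ n) :
    S (n + 1) = ∑ k ∈ Finset.range n, (n.choose k : ℤ[X]) * (s (n - k) * S (k + 1)) := by
  simp only [S_eq_upDownSum]
  exact upDownSum_recurrence n hn

theorem r_add_s (n : ℕ) (hn : 1 ≤ n) : (1 + X) * (r n + s n) = 2 * X * s n := by
  obtain ⟨m, rfl⟩ : ∃ m, n = m + 1 := ⟨n - 1, by omega⟩
  simp only [r, s, Nat.add_sub_cancel, pow_succ]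
  ring

/-- Multiplying by `1 + X` turns this into twice the recurrence for `S`, except at `k = 0`, where `2
* S 1 = 2X` differs from `(1 + X) * R 1 = 1 + X`; `r_add_s` absorbs the difference. -/
theorem R_recurrence (n : ℕ) (hn : 1 ≤ n) :
    R (n + 1) = r n +
      ∑ k ∈ Finset.range n, (n.choose k : ℤ[X]) * (s (n - k) * R (k + 1)) := by
  obtain ⟨m, rfl⟩ : ∃ m, n = m + 1 := ⟨n - 1, by omega⟩
  have hX : (1 + X : ℤ[X]) ≠ 0 := by
    rw [add_comm, ← C_1]
    exact X_add_C_ne_zero 1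
  apply mul_left_cancel₀ hX
  rw [← two_mul_S, S_recurrence (m + 1) hn, Finset.sum_range_succ', Finset.sum_range_succ',
    R_one, S_one]
  have hsum : 2 * ∑ k ∈ Finset.range m, ((m + 1).choose (k + 1) : ℤ[X]) *
      (s (m + 1 - (k + 1)) * S (k + 1 + 1)) =
      (1 + X) * ∑ k ∈ Finset.range m, ((m + 1).choose (k + 1) : ℤ[X]) *
      (s (m + 1 - (k + 1)) * R (k + 1 + 1)) := by
    rw [Finset.mul_sum, Finset.mul_sum]
    refine Finset.sum_congr rfl fun k _ => ?_
    linear_combination ((m + 1).choose (k + 1) : ℤ[X]) * s (m + 1 - (k + 1)) * two_mul_S k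
  have := r_add_s (m + 1) hn
  simp only [Nat.choose_zero_right, Nat.cast_one, Nat.sub_zero]
  linear_combination hsum - this

theorem isLowerHessenberg_matS (n : ℕ) : IsLowerHessenberg (matS n) := by
  intro i j h
  simp only [matS, Matrix.of_apply]
  rw [if_neg (by omega), if_neg (by omega), if_neg (by omega)]

theorem isLowerHessenberg_matR (n : ℕ) : IsLowerHessenberg (matR n) := by
  intro i j h
  simp only [matR, Matrix.of_apply]
  rw [if_neg (by omega), if_neg (by omega), if_neg (by omega)]

/-- Row `i` of a matrix with superdiagonal `-1` and zeros above it, applied to a vector. -/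
theorem sum_hessenberg_row {A : Type*} [CommRing A] (m i : ℕ) (hi : i ≤ m) (a v : ℕ → A)
    (hsup : a (i + 1) = -1) (hzero : ∀ j, i + 1 < j → a j = 0) :
    ∑ j ∈ Finset.range (m + 1), a j * v j =
      ∑ j ∈ Finset.range (i + 1), a j * v j - if i < m then v (i + 1) else 0 := by
  rcases hi.eq_or_lt with rfl | hlt
  · simp
  · rw [if_pos hlt, ← Finset.sum_subset (Finset.range_mono (show i + 1 + 1 ≤ m + 1 by omega)),
      Finset.sum_range_succ, hsup]
    · ring
    · intro j _ hj
      rw [hzero j (by simpa [Nat.lt_succ_iff] using hj), zero_mul]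

theorem S_eq_det_matS (n : ℕ) (hn : 1 ≤ n) : S (n + 1) = (matS n).det := by
  obtain ⟨m, rfl⟩ : ∃ m, n = m + 1 := ⟨n - 1, by omega⟩
  -- The entry at `0` is `1`, not `S 1 = X`, because the factor `X` already sits in the first
  -- column.
  let v : ℕ → ℤ[X] := fun j => if j = 0 then 1 else S (j + 1)
  have hrow : ∀ i, ∑ j ∈ Finset.range (i + 1),
      (if j = 0 then X * s (i + 1) else if j ≤ i then ((i + 1).choose j : ℤ[X]) * s (i + 1 - j)
        else if j = i + 1 then -1 else 0) * v j = S (i + 2) := by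
    intro i
    rw [S_recurrence (i + 1) (by omega)]
    refine Finset.sum_congr rfl fun j hj => ?_
    have hj' : j ≤ i := by simpa [Nat.lt_succ_iff] using hj
    rcases Nat.eq_zero_or_pos j with rfl | h0
    · simp [v, S_one, mul_comm]
    · simp [v, h0.ne', hj', mul_assoc]
  have := det_mul_eq_of_hessenberg (matS (m + 1)) (isLowerHessenberg_matS _)
    (fun i j h => by
      simp only [matS, Matrix.of_apply]
      rw [if_neg (by omega), if_neg (by omega), if_pos h])
    (fun j => v j) (S (m + 2)) (by
      ext1 i
      rw [Matrix.mulVec, dotProduct]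
      simp only [matS, Matrix.of_apply]
      rw [Fin.sum_univ_eq_sum_range (fun j => (if j = 0 then X * s ((i : ℕ) + 1) else
          if j ≤ i then (((i : ℕ) + 1).choose j : ℤ[X]) * s ((i : ℕ) + 1 - j)
          else if j = (i : ℕ) + 1 then -1 else 0) * v j),
        sum_hessenberg_row m i (Nat.lt_succ_iff.1 i.2) _ v (by simp)
          (fun j h => by rw [if_neg (by omega), if_neg (by omega), if_neg (by omega)]), hrow]
      by_cases h : (i : ℕ) < m
      · have hne : i ≠ Fin.last m := by rintro rfl; simp at h
        simp [h, hne, v]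
      · obtain rfl : i = Fin.last m := Fin.ext (by have := i.2; simp; omega)
        simp)
  simpa [v] using this.symm

theorem R_eq_det_matR (n : ℕ) : R (n + 1) = (matR n).det := by
  -- The entry `1` at `0` multiplies the column of the inhomogeneous terms `r i`.
  let v : ℕ → ℤ[X] := fun j => if j = 0 then 1 else R j
  have hrow : ∀ i, ∑ j ∈ Finset.range (i + 1),
      (if j = 0 then (if i = 0 then 1 else r i) else
        if j ≤ i then (i.choose (j - 1) : ℤ[X]) * s (i + 1 - j)
        else if j = i + 1 then -1 else 0) * v j = R (i + 1) := by
    intro i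
    rcases Nat.eq_zero_or_pos i with rfl | hi
    · simp [v, R_one]
    rw [R_recurrence i hi, Finset.sum_range_succ', add_comm]
    congr 1
    · simp [v, hi.ne']
    refine Finset.sum_congr rfl fun j hj => ?_
    have hj' : j + 1 ≤ i := by simpa [Nat.succ_le_iff] using hj
    simp [v, hj', mul_assoc]
  have := det_mul_eq_of_hessenberg (matR n) (isLowerHessenberg_matR _)
    (fun i j h => by
      simp only [matR, Matrix.of_apply]
      rw [if_neg (by omega), if_neg (by omega), if_pos h])
    (fun j => v j) (R (n + 1)) (by
      ext1 i
      rw [Matrix.mulVec, dotProduct]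
      simp only [matR, Matrix.of_apply]
      rw [Fin.sum_univ_eq_sum_range (fun j => (if j = 0 then (if (i : ℕ) = 0 then 1 else r i) else
          if j ≤ i then ((i : ℕ).choose (j - 1) : ℤ[X]) * s ((i : ℕ) + 1 - j)
          else if j = (i : ℕ) + 1 then -1 else 0) * v j),
        sum_hessenberg_row n i (Nat.lt_succ_iff.1 i.2) _ v (by simp)
          (fun j h => by rw [if_neg (by omega), if_neg (by omega), if_neg (by omega)]), hrow]
      by_cases h : (i : ℕ) < n
      · have hne : i ≠ Fin.last n := by rintro rfl; simp at h
        simp [h, hne, v]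
      · obtain rfl : i = Fin.last n := Fin.ext (by have := i.2; simp; omega)
        simp)
  simpa [v] using this.symm

end Determinants

end AltRun

theorem mainTheorem2 (n : ℕ) (hn : 1 ≤ n) :
    (AltRun.s 1 = 1 + Polynomial.X ∧ AltRun.r 1 = Polynomial.X - 1) ∧
    (AltRun.IsLowerHessenberg (AltRun.matS n) ∧
      AltRun.S (n + 1) = (AltRun.matS n).det) ∧
    (AltRun.IsLowerHessenberg (AltRun.matR n) ∧
      AltRun.R (n + 1) = (AltRun.matR n).det) :=
  ⟨⟨by simp [AltRun.s], by simp [AltRun.r]⟩,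
    ⟨AltRun.isLowerHessenberg_matS n, AltRun.S_eq_det_matS n hn⟩,
    ⟨AltRun.isLowerHessenberg_matR n, AltRun.R_eq_det_matR n⟩⟩
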